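/- Let $n,m,k$ be nonnegative integers, let $D\subseteq\mathbb R^m$ be non-empty, and write $\mathbb R_+=[0,\infty)$ and $|\cdot|$ for the Euclidean norm. Let $f:\mathbb R^n\times D\to\mathbb R^n$ be continuous with $f(0,d)=0$ for all $d\in D$, and such that for every compact $S\subseteq\mathbb R^n$ and every bounded $K\subseteq D$ there is $L>0$ with $|f(x,d)-f(z,d)|\le L|x-z|$ for all $x,z\in S$, $d\in K$. Let $h:\mathbb R^n\to\mathbb R^k$ be continuous with $h(0)=0$. Consider the system $\dot x=f(x,d)$, $y=h(x)$, with inputs $d\in L^\infty_{loc}(\mathbb R_+;D)$ (measurable, locally essentially bounded), and assume that it is forward complete: for all $x_0\in\mathbb R^n$ and all inputs $d$, the (unique, Carathéodory) solution $\phi(t,x_0;d)$ with $\phi(0,x_0;d)=x_0$ exists for all $t\ge0$. Put $y(t,x_0;d)=h(\phi(t,x_0;d))$. The system is called - *uniformly robustly globally output attractive (URGOA)* if for all $\varepsilon,R>0$ there is $T>0$ such that $|y(t,x_0;d)|\le\varepsilon$ for all inputs $d$, all $|x_0|\le R$ and all $t\ge T$; - *robustly Lyapunov output stable* if for every $\varepsilon>0$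 there is $\delta>0$ such that $|y(t,x_0;d)|\le\varepsilon$ for all inputs $d$, all $|x_0|\le\delta$ and all $t\ge0$; - *robustly Lagrange output stable* if for every $\delta>0$ there is $\varepsilon>0$ such that $|y(t,x_0;d)|\le\varepsilon$ for all inputs $d$, all $|x_0|\le\delta$ and all $t\ge0$; - *uniformly robustly globally asymptotically output stable (URGAOS)* if it has all three of these properties. Class $\mathcal K$ consists of the continuous strictly increasing $\alpha:\mathbb R_+\to\mathbb R_+$ with $\alpha(0)=0$, and $\mathcal K_\infty$ of those that moreover tend to $+\infty$. **Theorem 1.** Suppose that there are $V,W\in C^1(\mathbb R^n;\mathbb R_+)$ and a continuous $\rho:\mathbb R_+\to\mathbb R_+$ with $\rho(0)=0$ and $\rho(s)>0$ for $s>0$ such that $$\nabla V(x)f(x,d)\le-\rho(W(x))\qquad\text{for all }x\in\mathbb R^n,\ d\in D.$$ Suppose also that, for some constant $r>0$ and some $a\in\mathcal K$, for all $x\in\mathbb R^n$ with $W(x)<r$ and all $d\in D$, $$a(|h(x)|)\le W(x),\qquad \nabla W(x)f(x,d)\le0.$$ Assume that at least one of the following holds: i) $\liminf_{s\to+\infty}\rho(s)>0$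 (the value $+\infty$ being allowed); ii) there are $\zeta\in\mathcal K_\infty$ and $Q\in C^1(\mathbb R^n;\mathbb R_+)$ such that $W(x)\le\zeta(Q(x))$ and $\nabla Q(x)f(x,d)\le0$ for all $x\in\mathbb R^n$, $d\in D$. Then the system is URGOA and robustly Lyapunov output stable. If, in addition, $D$ is compact and for every compact $S\subseteq\mathbb R^n$ there is $L_S>0$ with $|f(x,d)-f(z,e)|\le L_S(|x-z|+|d-e|)$ for all $x,z\in S$ and $d,e\in D$, then the system is URGAOS. -/

import Mathlib

open Set Filter Topology MeasureTheory

namespace OutputStability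

/-- `ℝⁿ` with the Euclidean norm. -/
abbrev E (n : ℕ) : Type := EuclideanSpace ℝ (Fin n)

/-- Class `𝒦`: continuous (strictly) increasing functions `a : [0,∞) → [0,∞)` with `a 0 = 0`.
Only the values on `[0,∞)` matter; nonnegativity there follows from monotonicity. -/
def ClassK (a : ℝ → ℝ) : Prop :=
  ContinuousOn a (Ici 0) ∧ StrictMonoOn a (Ici 0) ∧ a 0 = 0

/-- Class `𝒦∞`: functions of class `𝒦` that tend to infinity. -/
def ClassKInf (a : ℝ → ℝ) : Prop :=
  ClassK a ∧ Tendsto a atTop atTop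

/-- Continuous positive definite functions `ρ : [0,∞) → [0,∞)`. -/
def ContPosDef (ρ : ℝ → ℝ) : Prop :=
  ContinuousOn ρ (Ici 0) ∧ ρ 0 = 0 ∧ ∀ s : ℝ, 0 < s → 0 < ρ s

/-- `C¹(ℝⁿ; [0,∞))`. -/
def C1Nonneg {n : ℕ} (V : E n → ℝ) : Prop :=
  ContDiff ℝ 1 V ∧ ∀ x, 0 ≤ V x

section System

variable {n m k : ℕ} {D : Set (E m)}

/-- The derivative `∇V(x) f(x,d)` of `V` along the vector field `f(·,d)` at `x`. -/
noncomputable def lieDeriv (f : E n × D → E n) (V : E n → ℝ) (x : E n) (d : D) : ℝ :=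
  fderiv ℝ V x (f (x, d))

/-- `f` is locally Lipschitz in the state, uniformly over bounded sets of inputs. -/
def LocLipState (f : E n × D → E n) : Prop :=
  ∀ S : Set (E n), IsCompact S → ∀ K : Set (E m), K ⊆ D → Bornology.IsBounded K →
    ∃ L : ℝ, 0 < L ∧ ∀ x ∈ S, ∀ z ∈ S, ∀ d : D, (d : E m) ∈ K →
      ‖f (x, d) - f (z, d)‖ ≤ L * ‖x - z‖

/-- Compact input set, and `f` locally Lipschitz in the state and the input jointly. -/
def CompactLipschitz (f : E n × D → E n) : Prop :=
  IsCompact D ∧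
  ∀ S : Set (E n), IsCompact S →
    ∃ L : ℝ, 0 < L ∧ ∀ x ∈ S, ∀ z ∈ S, ∀ d e : D,
      ‖f (x, d) - f (z, e)‖ ≤ L * (‖x - z‖ + ‖(d : E m) - (e : E m)‖)

/-- `d ∈ L^∞_loc([0,∞); D)`: (Lebesgue) measurable and locally essentially bounded on `[0,∞)`.
The values of `d` at negative times play no role anywhere. -/
def IsInput (d : ℝ → D) : Prop :=
  AEMeasurable d (volume.restrict (Ici (0 : ℝ))) ∧
  ∀ T : ℝ, ∃ M : ℝ, ∀ᵐ t ∂(volume.restrict (Icc (0 : ℝ) T)), ‖(d t : E m)‖ ≤ M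

/-- `x` is a (Carathéodory) solution on `[0,∞)` of `ẋ = f(x,d)`, `x(0) = x₀`.
The values of `x` at negative times play no role. -/
def IsSolution (f : E n × D → E n) (d : ℝ → D) (x₀ : E n) (x : ℝ → E n) : Prop :=
  ContinuousOn x (Ici 0) ∧
  ∀ t : ℝ, 0 ≤ t →
    IntervalIntegrable (fun s => f (x s, d s)) volume 0 t ∧
    x t = x₀ + ∫ s in (0 : ℝ)..t, f (x s, d s)

/-- Forward completeness: a solution on all of `[0,∞)` for every initial state and input. -/
def ForwardComplete (f : E n × D → E n) : Prop :=
  ∀ (x₀ : E n) (d : ℝ → D), IsInput d → ∃ x : ℝ → E n, IsSolution f d x₀ x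

/-- Uniform robust global output attractivity. -/
def URGOA (f : E n × D → E n) (h : E n → E k) : Prop :=
  ∀ ε : ℝ, 0 < ε → ∀ R : ℝ, 0 < R → ∃ T : ℝ, 0 < T ∧
    ∀ d : ℝ → D, IsInput d → ∀ x₀ : E n, ‖x₀‖ ≤ R →
      ∀ x : ℝ → E n, IsSolution f d x₀ x → ∀ t : ℝ, T ≤ t → ‖h (x t)‖ ≤ ε

/-- Robust Lyapunov output stability. -/
def LyapunovOutputStable (f : E n × D → E n) (h : E n → E k) : Prop :=
  ∀ ε : ℝ, 0 < ε → ∃ δ : ℝ, 0 < δ ∧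
    ∀ d : ℝ → D, IsInput d → ∀ x₀ : E n, ‖x₀‖ ≤ δ →
      ∀ x : ℝ → E n, IsSolution f d x₀ x → ∀ t : ℝ, 0 ≤ t → ‖h (x t)‖ ≤ ε

/-- Robust Lagrange output stability. -/
def LagrangeOutputStable (f : E n × D → E n) (h : E n → E k) : Prop :=
  ∀ δ : ℝ, 0 < δ → ∃ ε : ℝ, 0 < ε ∧
    ∀ d : ℝ → D, IsInput d → ∀ x₀ : E n, ‖x₀‖ ≤ δ →
      ∀ x : ℝ → E n, IsSolution f d x₀ x → ∀ t : ℝ, 0 ≤ t → ‖h (x t)‖ ≤ ε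

/-- Uniform robust global asymptotic output stability. -/
def URGAOS (f : E n × D → E n) (h : E n → E k) : Prop :=
  LagrangeOutputStable f h ∧ LyapunovOutputStable f h ∧ URGOA f h

end System

end OutputStability

/-!
Along solutions, `V` decreases at a definite rate as long as `W` is not small, so `W` becomes small
within a time depending only on the size of the initial state; from then on `W` cannot increase
and keeps the output small.

For Lagrange stability it remains to bound the output up to that time, that is, to show that
finitely many units of time only lead from a bounded set to a bounded set. Suppose not. By
compactness, solutions from states arbitrarily near some state `x` get arbitrarily far. Over short
times the flow maps are small Lipschitz perturbations of the identity, uniformly in the input, so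
they are open; hence the states near which escape happens can be reached exactly, from states
close to `x`, and escape persists from there until the solution is far away. Repeating this with
shrinking compact sets of initial states and longer and longer pieces of input, one finds in the
limit a single initial state and a single input whose solution is unbounded in finite time,
contradicting forward completeness.
-/

namespace OutputStability

open Metric

section RealFunctions

theorem exists_first_hit {α β : Type*} [ConditionallyCompleteLinearOrder α] [TopologicalSpace α]
    [OrderTopology α] [DenselyOrdered α] [LinearOrder β] [TopologicalSpace β]
    [OrderClosedTopology β] {g : α → β} {a b : α} {c : β} (hg : ContinuousOn g (Icc a b))
    (hab : a ≤ b) (ha : g a ≤ c) (hb : c ≤ g b) :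
    ∃ τ ∈ Icc a b, g τ = c ∧ ∀ t ∈ Icc a τ, g t ≤ c := by
  have hcompact : IsCompact (Icc a b ∩ g ⁻¹' Ici c) :=
    isCompact_Icc.of_isClosed_subset (hg.preimage_isClosed_of_isClosed isClosed_Icc isClosed_Ici)
      inter_subset_left
  obtain ⟨τ, ⟨hτ, hcτ⟩, hleast⟩ := hcompact.exists_isLeast ⟨b, right_mem_Icc.2 hab, hb⟩
  have hτc : g τ = c := by
    obtain ⟨σ, hσ, rfl⟩ :=
      intermediate_value_Icc hτ.1 (hg.mono (Icc_subset_Icc_right hτ.2)) ⟨ha, hcτ⟩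
    rw [hσ.2.antisymm (hleast ⟨⟨hσ.1, hσ.2.trans hτ.2⟩, self_mem_Ici⟩)]
  refine ⟨τ, hτ, hτc, fun t ht => ?_⟩
  by_contra! hlt
  have hle : τ ≤ t := hleast ⟨⟨ht.1, ht.2.trans hτ.2⟩, hlt.le⟩
  rw [ht.2.antisymm hle, hτc] at hlt
  exact hlt.false

theorem absolutelyContinuousOnInterval_of_dist_le {X Y : Type*} [PseudoMetricSpace X]
    [PseudoMetricSpace Y] {g : ℝ → X} {φ : ℝ → Y} {a b : ℝ} {K : NNReal}
    (hg : AbsolutelyContinuousOnInterval g a b)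
    (hφ : ∀ s ∈ uIcc a b, ∀ t ∈ uIcc a b, dist (φ s) (φ t) ≤ K * dist (g s) (g t)) :
    AbsolutelyContinuousOnInterval φ a b := by
  rw [absolutelyContinuousOnInterval_iff] at hg ⊢
  intro ε hε
  have hK : (0 : ℝ) < K + 1 := by positivity
  obtain ⟨δ, hδ, hsum⟩ := hg (ε / (K + 1)) (by positivity)
  refine ⟨δ, hδ, fun I hI hlt => ?_⟩
  have hlt' := hsum I hI hlt
  rw [lt_div_iff₀ hK, Finset.sum_mul] at hlt'
  refine (Finset.sum_le_sum fun i hi => ?_).trans_lt hlt'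
  have hmem := hI.1 i hi
  have hle := hφ _ hmem.1 _ hmem.2
  linarith [dist_nonneg (x := g (I.2 i).1) (y := g (I.2 i).2)]

theorem hasDerivWithinAt_integral_Ici {φ : ℝ → ℝ} {a b x : ℝ} (hφ : ContinuousOn φ (Icc a b))
    (hx : x ∈ Ico a b) : HasDerivWithinAt (fun t => ∫ s in a..t, φ s) (φ x) (Ici x) x := by
  have hnhds : Icc a b ∈ 𝓝[>] x :=
    mem_of_superset (Ioc_mem_nhdsGT hx.2) fun y hy => ⟨hx.1.trans hy.1.le, hy.2⟩
  exact intervalIntegral.integral_hasDerivWithinAt_right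
    ((hφ.mono (Icc_subset_Icc_right hx.2.le)).intervalIntegrable_of_Icc hx.1)
    ⟨Icc a b, hnhds, hφ.aestronglyMeasurable measurableSet_Icc⟩
    ((hφ x (Ico_subset_Icc_self hx)).mono_of_mem_nhdsWithin hnhds)

theorem le_mul_exp_of_le_add_integral {φ : ℝ → ℝ} {a b δ L : ℝ} (hL : 0 ≤ L)
    (hφ : ContinuousOn φ (Icc a b)) (hle : ∀ t ∈ Icc a b, φ t ≤ δ + L * ∫ s in a..t, φ s)
    {t : ℝ} (ht : t ∈ Icc a b) : φ t ≤ δ * Real.exp (L * (t - a)) := by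
  have hab : a ≤ b := ht.1.trans ht.2
  have hcont : ContinuousOn (fun t => δ + L * ∫ s in a..t, φ s) (Icc a b) := by
    have hprim := intervalIntegral.continuousOn_primitive_interval' (μ := volume)
      (hφ.intervalIntegrable_of_Icc hab) left_mem_uIcc
    rw [uIcc_of_le hab] at hprim
    fun_prop
  have hgronwall := le_gronwallBound_of_liminf_deriv_right_le (δ := δ) (K := L) (ε := 0) hcont
    (fun x hx r hr => HasDerivWithinAt.liminf_right_slope_le
      (((hasDerivWithinAt_integral_Ici hφ hx).const_mul L).const_add δ) hr)
    (by simp)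
    (fun x hx => by
      simpa using mul_le_mul_of_nonneg_left (hle x (Ico_subset_Icc_self hx)) hL) t ht
  rw [gronwallBound_ε0] at hgronwall
  exact (hle t ht).trans hgronwall

end RealFunctions

section Solutions

variable {n m : ℕ} {D : Set (E m)} {f : E n × D → E n} {d e : ℝ → D} {x₀ y₀ : E n}
  {x y : ℝ → E n}

namespace IsSolution

theorem apply_zero (hx : IsSolution f d x₀ x) : x 0 = x₀ := by
  simpa using (hx.2 0 le_rfl).2

theorem intervalIntegrable (hx : IsSolution f d x₀ x) {a b : ℝ} (ha : 0 ≤ a) (hb : 0 ≤ b) :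
    IntervalIntegrable (fun s => f (x s, d s)) volume a b :=
  (hx.2 a ha).1.symm.trans (hx.2 b hb).1

theorem eq_add_integral (hx : IsSolution f d x₀ x) {a b : ℝ} (ha : 0 ≤ a) (hb : 0 ≤ b) :
    x b = x a + ∫ s in a..b, f (x s, d s) := by
  rw [(hx.2 a ha).2, (hx.2 b hb).2, add_assoc,
    intervalIntegral.integral_add_adjacent_intervals (hx.2 a ha).1 (hx.intervalIntegrable ha hb)]

theorem continuousOn_Icc (hx : IsSolution f d x₀ x) {a b : ℝ} (ha : 0 ≤ a) :
    ContinuousOn x (Icc a b) :=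
  hx.1.mono fun _ ht => ha.trans ht.1

theorem exists_norm_le (hx : IsSolution f d x₀ x) (T : ℝ) : ∃ M, ∀ t ∈ Icc 0 T, ‖x t‖ ≤ M :=
  isCompact_Icc.exists_bound_of_continuousOn (hx.continuousOn_Icc le_rfl)

theorem shift (hx : IsSolution f d x₀ x) {a : ℝ} (ha : 0 ≤ a) :
    IsSolution f (fun t => d (t + a)) (x a) (fun t => x (t + a)) := by
  refine ⟨hx.1.comp (by fun_prop) fun t ht => add_nonneg ht ha, fun t ht => ⟨?_, ?_⟩⟩
  · simpa using (hx.intervalIntegrable ha (add_nonneg ht ha)).comp_add_right a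
  · rw [intervalIntegral.integral_comp_add_right (fun s => f (x s, d s)), zero_add]
    exact hx.eq_add_integral ha (add_nonneg ht ha)

theorem ae_hasDerivAt (hx : IsSolution f d x₀ x) {a b : ℝ} (ha : 0 ≤ a) (hab : a ≤ b) :
    ∀ᵐ t, t ∈ Icc a b → HasDerivAt x (f (x t, d t)) t := by
  filter_upwards [(hx.intervalIntegrable ha (ha.trans hab)).ae_hasDerivAt_integral,
    Measure.ae_ne volume 0] with t hderiv ht0 ht
  rw [uIcc_of_le hab] at hderiv
  have htpos : 0 < t := (ha.trans ht.1).lt_of_ne' ht0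
  refine ((hderiv ht a (left_mem_Icc.2 hab)).const_add (x a)).congr_of_eventuallyEq ?_
  filter_upwards [Ioi_mem_nhds htpos] with s hs
  exact hx.eq_add_integral ha (le_of_lt hs)

theorem absolutelyContinuousOnInterval (hx : IsSolution f d x₀ x) {a b : ℝ} (ha : 0 ≤ a)
    (hab : a ≤ b) : AbsolutelyContinuousOnInterval x a b := by
  have hspeed := (hx.intervalIntegrable ha (ha.trans hab)).norm
  refine absolutelyContinuousOnInterval_of_dist_le (K := 1)
    (hspeed.absolutelyContinuousOnInterval_intervalIntegral left_mem_uIcc) fun s hs t ht => ?_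
  rw [uIcc_of_le hab] at hs ht
  have hs0 := ha.trans hs.1
  have ht0 := ha.trans ht.1
  rw [dist_comm, dist_comm (∫ τ in a..s, _), hx.eq_add_integral hs0 ht0, dist_eq_norm,
    add_sub_cancel_left, Real.dist_eq, intervalIntegral.integral_interval_sub_left
      (hx.intervalIntegrable ha ht0).norm (hx.intervalIntegrable ha hs0).norm, NNReal.coe_one,
    one_mul]
  exact intervalIntegral.norm_integral_le_abs_integral_norm

theorem absolutelyContinuousOnInterval_comp (hx : IsSolution f d x₀ x) {U : E n → ℝ}
    (hU : ContDiff ℝ 1 U) {a b : ℝ} (ha : 0 ≤ a) (hab : a ≤ b) :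
    AbsolutelyContinuousOnInterval (U ∘ x) a b := by
  obtain ⟨R, hR⟩ := hx.exists_norm_le b
  obtain ⟨K, hK⟩ := (hU.contDiffOn (s := closedBall 0 R)).exists_lipschitzOnWith one_ne_zero
    (convex_closedBall _ _) (isCompact_closedBall _ _)
  have hball : ∀ t ∈ uIcc a b, x t ∈ closedBall 0 R := fun t ht => by
    rw [uIcc_of_le hab] at ht
    exact mem_closedBall_zero_iff.2 (hR t ⟨ha.trans ht.1, ht.2⟩)
  exact absolutelyContinuousOnInterval_of_dist_le (hx.absolutelyContinuousOnInterval ha hab)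
    fun s hs t ht => hK.dist_le_mul _ (hball s hs) _ (hball t ht)

theorem comp_le_sub_of_lieDeriv_le (hx : IsSolution f d x₀ x) {U : E n → ℝ}
    (hU : ContDiff ℝ 1 U) {a b c : ℝ} (ha : 0 ≤ a) (hab : a ≤ b)
    (hc : ∀ t ∈ Icc a b, lieDeriv f U (x t) (d t) ≤ -c) :
    U (x b) ≤ U (x a) - c * (b - a) := by
  have hac := hx.absolutelyContinuousOnInterval_comp hU ha hab
  have hderiv : ∀ᵐ t, t ∈ Icc a b → deriv (U ∘ x) t ≤ -c := by
    filter_upwards [hx.ae_hasDerivAt ha hab] with t hxt ht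
    have hUt := (hU.differentiable one_ne_zero (x t)).hasFDerivAt
    exact (hUt.comp_hasDerivAt t (hxt ht)).deriv.trans_le (hc t ht)
  have hintegral := intervalIntegral.integral_mono_ae_restrict hab hac.intervalIntegrable_deriv
    (intervalIntegrable_const (c := -c)) ((ae_restrict_iff' measurableSet_Icc).2 hderiv)
  rw [hac.integral_deriv_eq_sub, intervalIntegral.integral_const, smul_eq_mul] at hintegral
  simp only [Function.comp_apply] at hintegral
  linarith

theorem comp_le_of_lieDeriv_nonpos (hx : IsSolution f d x₀ x) {U : E n → ℝ}
    (hU : ContDiff ℝ 1 U) {a b : ℝ} (ha : 0 ≤ a) (hab : a ≤ b)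
    (hdec : ∀ t ∈ Icc a b, lieDeriv f U (x t) (d t) ≤ 0) : U (x b) ≤ U (x a) := by
  simpa using hx.comp_le_sub_of_lieDeriv_le (c := 0) hU ha hab (by simpa using hdec)

theorem comp_le_of_lieDeriv_nonpos_below (hx : IsSolution f d x₀ x) {U : E n → ℝ}
    (hU : ContDiff ℝ 1 U) {r : ℝ} (hdec : ∀ z, U z < r → ∀ e : D, lieDeriv f U z e ≤ 0)
    {a b : ℝ} (ha : 0 ≤ a) (hab : a ≤ b) (hr : U (x a) < r) : U (x b) ≤ U (x a) := by
  by_contra! hlt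
  obtain ⟨c, hac, hc⟩ := exists_between (lt_min hr hlt)
  rw [lt_min_iff] at hc
  obtain ⟨τ, hτ, hτc, hbelow⟩ := exists_first_hit
    (hU.continuous.comp_continuousOn (hx.continuousOn_Icc ha)) hab hac.le hc.2.le
  have hle := hx.comp_le_of_lieDeriv_nonpos hU ha hτ.1 fun t ht =>
    hdec _ ((hbelow t ht).trans_lt hc.1) _
  exact (hac.trans_eq hτc.symm).not_ge hle

theorem norm_lt_of_norm_le (hx : IsSolution f d x₀ x) {B ρ t : ℝ} (hB : 0 ≤ B)
    (hf : ∀ z ∈ closedBall (0 : E n) ρ, ∀ e : D, ‖f (z, e)‖ ≤ B) (ht : 0 ≤ t)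
    (hρ : ‖x₀‖ + B * t < ρ) : ‖x t‖ < ρ := by
  by_contra! hge
  have h0 : ‖x 0‖ ≤ ρ := by
    rw [hx.apply_zero]
    linarith [mul_nonneg hB ht]
  obtain ⟨τ, hτ, hτρ, hbefore⟩ :=
    exists_first_hit (hx.continuousOn_Icc le_rfl).norm ht h0 hge
  have hint : ‖∫ s in (0 : ℝ)..τ, f (x s, d s)‖ ≤ B * |τ - 0| := by
    refine intervalIntegral.norm_integral_le_of_norm_le_const fun s hs => ?_
    rw [uIoc_of_le hτ.1] at hs
    exact hf _ (mem_closedBall_zero_iff.2 (hbefore s ⟨hs.1.le, hs.2⟩)) _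
  have hlt : ‖x τ‖ < ρ :=
    calc ‖x τ‖ ≤ ‖x₀‖ + ‖∫ s in (0 : ℝ)..τ, f (x s, d s)‖ :=
          (hx.2 τ hτ.1).2 ▸ norm_add_le _ _
      _ ≤ ‖x₀‖ + B * τ := by simpa [abs_of_nonneg hτ.1] using hint
      _ ≤ ‖x₀‖ + B * t := by gcongr; exact hτ.2
      _ < ρ := hρ
  exact hlt.ne hτρ

theorem norm_sub_sub_le_integral (hx : IsSolution f d x₀ x) (hy : IsSolution f e y₀ y) {L t : ℝ}
    (hlip : ∀ᵐ τ, τ ∈ Ioc 0 t → ‖f (x τ, d τ) - f (y τ, e τ)‖ ≤ L * ‖x τ - y τ‖) (ht : 0 ≤ t) :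
    ‖x t - y t - (x₀ - y₀)‖ ≤ L * ∫ τ in (0 : ℝ)..t, ‖x τ - y τ‖ := by
  rw [(hx.2 t ht).2, (hy.2 t ht).2, add_sub_add_comm, add_sub_cancel_left,
    ← intervalIntegral.integral_sub (hx.2 t ht).1 (hy.2 t ht).1,
    ← intervalIntegral.integral_const_mul]
  have hcont : ContinuousOn (fun τ => ‖x τ - y τ‖) (Icc 0 t) :=
    ((hx.continuousOn_Icc le_rfl).sub (hy.continuousOn_Icc le_rfl)).norm
  exact intervalIntegral.norm_integral_le_of_norm_le ht hlip
    ((hcont.intervalIntegrable_of_Icc ht).const_mul L)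

theorem norm_sub_le_mul_exp (hx : IsSolution f d x₀ x) (hy : IsSolution f e y₀ y) {L s t : ℝ}
    (hL : 0 ≤ L)
    (hlip : ∀ᵐ τ, τ ∈ Ioc 0 s → ‖f (x τ, d τ) - f (y τ, e τ)‖ ≤ L * ‖x τ - y τ‖)
    (ht : t ∈ Icc 0 s) : ‖x t - y t‖ ≤ ‖x₀ - y₀‖ * Real.exp (L * t) := by
  have hcont : ContinuousOn (fun τ => ‖x τ - y τ‖) (Icc 0 s) :=
    ((hx.continuousOn_Icc le_rfl).sub (hy.continuousOn_Icc le_rfl)).norm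
  refine (le_mul_exp_of_le_add_integral hL hcont (fun τ hτ => ?_) ht).trans_eq (by rw [sub_zero])
  have hdiff := hx.norm_sub_sub_le_integral hy
    (hlip.mono fun σ hσ hσ' => hσ ⟨hσ'.1, hσ'.2.trans hτ.2⟩) hτ.1
  linarith [norm_sub_norm_le (x τ - y τ) (x₀ - y₀)]

theorem norm_sub_sub_le (hx : IsSolution f d x₀ x) (hy : IsSolution f e y₀ y) {L t : ℝ}
    (hL : 0 ≤ L)
    (hlip : ∀ᵐ τ, τ ∈ Ioc 0 t → ‖f (x τ, d τ) - f (y τ, e τ)‖ ≤ L * ‖x τ - y τ‖) (ht : 0 ≤ t) :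
    ‖x t - y t - (x₀ - y₀)‖ ≤ L * t * Real.exp (L * t) * ‖x₀ - y₀‖ := by
  have hcont : ContinuousOn (fun τ => ‖x τ - y τ‖) (Icc 0 t) :=
    ((hx.continuousOn_Icc le_rfl).sub (hy.continuousOn_Icc le_rfl)).norm
  have hintegral : ∫ τ in (0 : ℝ)..t, ‖x τ - y τ‖ ≤ t * (‖x₀ - y₀‖ * Real.exp (L * t)) :=
    calc ∫ τ in (0 : ℝ)..t, ‖x τ - y τ‖
        ≤ ∫ _τ in (0 : ℝ)..t, ‖x₀ - y₀‖ * Real.exp (L * t) :=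
          intervalIntegral.integral_mono_on ht (hcont.intervalIntegrable_of_Icc ht)
            intervalIntegrable_const fun τ hτ =>
              (hx.norm_sub_le_mul_exp hy hL hlip hτ).trans (by gcongr; exact hτ.2)
      _ = t * (‖x₀ - y₀‖ * Real.exp (L * t)) := by
          rw [intervalIntegral.integral_const, smul_eq_mul, sub_zero]
  calc ‖x t - y t - (x₀ - y₀)‖ ≤ L * ∫ τ in (0 : ℝ)..t, ‖x τ - y τ‖ :=
        hx.norm_sub_sub_le_integral hy hlip ht
    _ ≤ L * (t * (‖x₀ - y₀‖ * Real.exp (L * t))) := by gcongr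
    _ = L * t * Real.exp (L * t) * ‖x₀ - y₀‖ := by ring

theorem eqOn_of_eqOn_input (hf : LocLipState f) (hd : IsInput d) (hx : IsSolution f d x₀ x)
    (hy : IsSolution f e x₀ y) {s : ℝ} (hde : EqOn d e (Ico 0 s)) : EqOn x y (Icc 0 s) := by
  obtain ⟨M, hM⟩ := hx.exists_norm_le s
  obtain ⟨N, hN⟩ := hy.exists_norm_le s
  obtain ⟨C, hC⟩ := hd.2 s
  obtain ⟨L, hL, hlip⟩ := hf _ (isCompact_closedBall 0 (max M N)) (D ∩ closedBall 0 C)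
    inter_subset_left (isBounded_closedBall.subset inter_subset_right)
  have hae : ∀ᵐ τ, τ ∈ Ioc 0 s → ‖f (x τ, d τ) - f (y τ, e τ)‖ ≤ L * ‖x τ - y τ‖ := by
    filter_upwards [(ae_restrict_iff' measurableSet_Icc).1 hC, Measure.ae_ne volume s]
      with τ hdτ hτs hτ
    have hmem : τ ∈ Icc 0 s := Ioc_subset_Icc_self hτ
    rw [← hde ⟨hmem.1, hmem.2.lt_of_ne hτs⟩]
    exact hlip _ (mem_closedBall_zero_iff.2 ((hM τ hmem).trans (le_max_left _ _)))
      _ (mem_closedBall_zero_iff.2 ((hN τ hmem).trans (le_max_right _ _)))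
      _ ⟨(d τ).2, mem_closedBall_zero_iff.2 (hdτ hmem)⟩
  intro t ht
  simpa [sub_eq_zero] using hx.norm_sub_le_mul_exp hy hL.le hae ht

end IsSolution

end Solutions

section Dissipation

variable {n m k : ℕ} {D : Set (E m)} {f : E n × D → E n} {h : E n → E k} {V W Q : E n → ℝ}
  {ρ : ℝ → ℝ}

/-- `V` decreases at a definite rate along solutions as long as `W` stays away from `0`, uniformly
over all inputs and over bounded sets of initial states. -/
def DecaysUniformly (f : E n × D → E n) (V W : E n → ℝ) : Prop :=
  ∀ η : ℝ, 0 < η → ∀ R : ℝ, ∃ c : ℝ, 0 < c ∧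
    ∀ (d : ℝ → D) (x₀ : E n), ‖x₀‖ ≤ R → ∀ x : ℝ → E n, IsSolution f d x₀ x →
      ∀ t : ℝ, 0 ≤ t → η ≤ W (x t) → lieDeriv f V (x t) (d t) ≤ -c

/-- Once a solution has made `W` small, its output is small forever. -/
def TrapsOutput (f : E n × D → E n) (W : E n → ℝ) (h : E n → E k) : Prop :=
  ∀ ε : ℝ, 0 < ε → ∃ η : ℝ, 0 < η ∧
    ∀ (d : ℝ → D) (x₀ : E n) (x : ℝ → E n), IsSolution f d x₀ x →
      ∀ s t : ℝ, 0 ≤ s → s ≤ t → W (x s) < η → ‖h (x t)‖ ≤ ε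

theorem ContPosDef.exists_pos_le (hρ : ContPosDef ρ) {η : ℝ} (hη : 0 < η) (M : ℝ) :
    ∃ c, 0 < c ∧ ∀ s ∈ Icc η M, c ≤ ρ s :=
  isCompact_Icc.exists_forall_le' (hρ.1.mono fun _ hs => hη.le.trans hs.1)
    fun s hs => hρ.2.2 s (hη.trans_le hs.1)

theorem decaysUniformly_of_liminf_pos (hρ : ContPosDef ρ)
    (hVdiss : ∀ (x : E n) (d : D), lieDeriv f V x d ≤ -ρ (W x))
    (hlim : 0 < liminf (fun s : ℝ => ((ρ s : ℝ) : EReal)) atTop) : DecaysUniformly f V W := by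
  intro η hη R
  obtain ⟨c₁, hc₁, hlt⟩ := EReal.lt_iff_exists_real_btwn.1 hlim
  obtain ⟨N, hfar⟩ := eventually_atTop.1 (eventually_lt_of_lt_liminf hlt)
  obtain ⟨c₂, hc₂, hnear⟩ := hρ.exists_pos_le hη N
  refine ⟨min c₁ c₂, lt_min (EReal.coe_pos.1 hc₁) hc₂, fun d x₀ _ x _ t _ hηW => ?_⟩
  refine (hVdiss _ _).trans (neg_le_neg ?_)
  rcases le_total (W (x t)) N with hWN | hNW
  · exact min_le_of_right_le (hnear _ ⟨hηW, hWN⟩)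
  · exact min_le_of_left_le (EReal.coe_lt_coe_iff.1 (hfar _ hNW)).le

theorem decaysUniformly_of_le_comp (hρ : ContPosDef ρ)
    (hVdiss : ∀ (x : E n) (d : D), lieDeriv f V x d ≤ -ρ (W x)) {ζ : ℝ → ℝ}
    (hζ : MonotoneOn ζ (Ici 0)) (hQ : C1Nonneg Q) (hWQ : ∀ x, W x ≤ ζ (Q x))
    (hQdec : ∀ (x : E n) (d : D), lieDeriv f Q x d ≤ 0) : DecaysUniformly f V W := by
  intro η hη R
  obtain ⟨M, hM⟩ := (isCompact_closedBall (0 : E n) R).bddAbove_image hQ.1.continuous.continuousOn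
  obtain ⟨c, hc, hcρ⟩ := hρ.exists_pos_le hη (ζ M)
  refine ⟨c, hc, fun d x₀ hx₀ x hx t ht hηW => (hVdiss _ _).trans (neg_le_neg ?_)⟩
  have hQM : Q (x t) ≤ M :=
    calc Q (x t) ≤ Q (x 0) := hx.comp_le_of_lieDeriv_nonpos hQ.1 le_rfl ht fun _ _ => hQdec _ _
      _ ≤ M := hx.apply_zero ▸ hM (mem_image_of_mem Q (mem_closedBall_zero_iff.2 hx₀))
  exact hcρ _ ⟨hηW, (hWQ _).trans (hζ (hQ.2 _) ((hQ.2 _).trans hQM) hQM)⟩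

theorem trapsOutput_of_lieDeriv_nonpos_below (hW : ContDiff ℝ 1 W) {r : ℝ} (hr : 0 < r)
    {a : ℝ → ℝ} (ha : ClassK a) (hWh : ∀ x, W x < r → a ‖h x‖ ≤ W x)
    (hWdec : ∀ x, W x < r → ∀ d : D, lieDeriv f W x d ≤ 0) : TrapsOutput f W h := by
  intro ε hε
  have haε : 0 < a ε := ha.2.2 ▸ ha.2.1 self_mem_Ici hε.le hε
  refine ⟨min r (a ε), lt_min hr haε, fun d x₀ x hx s t hs hst hlt => ?_⟩
  rw [lt_min_iff] at hlt
  have hWt : W (x t) ≤ W (x s) := hx.comp_le_of_lieDeriv_nonpos_below hW hWdec hs hst hlt.1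
  have hah : a ‖h (x t)‖ ≤ a ε := (hWh _ (hWt.trans_lt hlt.1)).trans (hWt.trans hlt.2.le)
  exact (ha.2.1.le_iff_le (norm_nonneg _) hε.le).1 hah

theorem urgoa_of_decaysUniformly (hV : C1Nonneg V) (hdecay : DecaysUniformly f V W)
    (htrap : TrapsOutput f W h) : URGOA f h := by
  intro ε hε R hR
  obtain ⟨η, hη, htrap⟩ := htrap ε hε
  obtain ⟨c, hc, hdecay⟩ := hdecay η hη R
  obtain ⟨M, hM⟩ := (isCompact_closedBall (0 : E n) R).bddAbove_image hV.1.continuous.continuousOn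
  have hM0 : 0 ≤ M := (hV.2 0).trans (hM (mem_image_of_mem V (mem_closedBall_self hR.le)))
  have hT : 0 < (M + 1) / c := by positivity
  refine ⟨(M + 1) / c, hT, fun d _ x₀ hx₀ x hx t ht => ?_⟩
  obtain ⟨s, hs, hsW⟩ : ∃ s ∈ Icc 0 ((M + 1) / c), W (x s) < η := by
    by_contra! hge
    have hdrop := hx.comp_le_sub_of_lieDeriv_le hV.1 le_rfl hT.le fun s hs =>
      hdecay d x₀ hx₀ x hx s hs.1 (hge s hs)
    have hVx₀ : V x₀ ≤ M := hM (mem_image_of_mem V (mem_closedBall_zero_iff.2 hx₀))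
    rw [hx.apply_zero, sub_zero, mul_div_cancel₀ _ hc.ne'] at hdrop
    linarith [hV.2 (x ((M + 1) / c))]
  exact htrap d x₀ x hx s t hs.1 (hs.2.trans ht) hsW

theorem eq_zero_of_lieDeriv_le_neg (hD : D.Nonempty) (hf0 : ∀ d, f (0, d) = 0)
    (hW : 0 ≤ W 0) (hρ : ∀ s, 0 < s → 0 < ρ s)
    (hVdiss : ∀ (x : E n) (d : D), lieDeriv f V x d ≤ -ρ (W x)) : W 0 = 0 := by
  obtain ⟨d₀, hd₀⟩ := hD
  have hle := hVdiss 0 ⟨d₀, hd₀⟩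
  rw [lieDeriv, hf0, map_zero] at hle
  by_contra hne
  linarith [hρ _ (hW.lt_of_ne' hne)]

theorem lyapunovOutputStable_of_trapsOutput (hW : ContinuousAt W 0) (hW0 : W 0 = 0)
    (htrap : TrapsOutput f W h) : LyapunovOutputStable f h := by
  intro ε hε
  obtain ⟨η, hη, htrap⟩ := htrap ε hε
  have hsmall : ∀ᶠ x in 𝓝 0, W x < η := hW.eventually_lt_const (by rwa [hW0])
  obtain ⟨δ, hδ, hball⟩ := nhds_basis_closedBall.mem_iff.1 hsmall
  refine ⟨δ, hδ, fun d _ x₀ hx₀ x hx t ht => htrap d x₀ x hx 0 t le_rfl ht ?_⟩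
  exact hx.apply_zero ▸ hball (mem_closedBall_zero_iff.2 hx₀)

end Dissipation

section NearIdentity

variable {𝕜 F : Type*} [NontriviallyNormedField 𝕜] [NormedAddCommGroup F] [NormedSpace 𝕜 F]

/-- The identity as a right inverse of itself with constant `1`. The linear inverse would have
constant `‖id‖`, which is `0` when `F` is trivial. -/
def idRightInverse (𝕜 F : Type*) [NontriviallyNormedField 𝕜] [NormedAddCommGroup F]
    [NormedSpace 𝕜 F] : (ContinuousLinearMap.id 𝕜 F).NonlinearRightInverse where
  toFun := id
  nnnorm := 1
  bound' := by simp
  right_inv' := by simp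

variable [CompleteSpace F] {g : F → F} {s : Set F} {c : NNReal} {x : F}

theorem closedBall_subset_image_closedBall
    (hg : ApproximatesLinearOn g (ContinuousLinearMap.id 𝕜 F) s c) {r : ℝ} (hr : 0 ≤ r)
    (hs : closedBall x r ⊆ s) : closedBall (g x) ((1 - c) * r) ⊆ g '' closedBall x r := by
  simpa [idRightInverse, SurjOn] using
    hg.surjOn_closedBall_of_nonlinearRightInverse (idRightInverse 𝕜 F) hr hs

theorem map_nhds_eq_of_approximatesLinearOn_id
    (hg : ApproximatesLinearOn g (ContinuousLinearMap.id 𝕜 F) s c) (hc : c < 1) (hs : s ∈ 𝓝 x) :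
    map g (𝓝 x) = 𝓝 (g x) :=
  hg.map_nhds_eq (idRightInverse 𝕜 F) hs (Or.inr (by simpa [idRightInverse] using hc))

end NearIdentity

section Flow

variable {n m : ℕ} {D : Set (E m)} {f : E n × D → E n} {d e : ℝ → D} {x₀ : E n} {x : ℝ → E n}

/-- The value at time `t` of the solution with input `d` starting at `x`. It is meaningless when
there is no such solution. -/
noncomputable def flow (f : E n × D → E n) (d : ℝ → D) (t : ℝ) (x : E n) : E n :=
  Classical.epsilon (IsSolution f d x) t

/-- The input that follows `d` up to time `s` and then runs `e` from its beginning. -/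
noncomputable def concat (d : ℝ → D) (s : ℝ) (e : ℝ → D) (t : ℝ) : D :=
  if t < s then d t else e (t - s)

theorem measurable_concat (hd : Measurable d) (he : Measurable e) (s : ℝ) :
    Measurable (concat d s e) :=
  Measurable.ite measurableSet_Iio hd (he.comp (measurable_id.sub_const s))

theorem eqOn_concat (d : ℝ → D) (s : ℝ) (e : ℝ → D) : EqOn (concat d s e) d (Iio s) :=
  fun _ ht => if_pos ht

theorem concat_add (d : ℝ → D) (s : ℝ) (e : ℝ → D) {t : ℝ} (ht : 0 ≤ t) :
    concat d s e (t + s) = e t := by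
  rw [concat, if_neg (by linarith), add_sub_cancel_right]

theorem IsSolution.congr_input (hx : IsSolution f d x₀ x)
    (hde : d =ᵐ[volume.restrict (Ici 0)] e) : IsSolution f e x₀ x := by
  refine ⟨hx.1, fun t ht => ?_⟩
  have hae : ∀ᵐ s, s ∈ uIoc 0 t → f (x s, d s) = f (x s, e s) := by
    filter_upwards [(ae_restrict_iff' measurableSet_Ici).1 hde] with s hs hst
    rw [uIoc_of_le ht] at hst
    rw [hs (le_of_lt hst.1)]
  exact ⟨(hx.2 t ht).1.congr_ae ((ae_restrict_iff' measurableSet_uIoc).2 hae),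
    (hx.2 t ht).2.trans (by rw [intervalIntegral.integral_congr_ae hae])⟩

/-- Forward complete systems whose inputs, and whose speed at the origin, are bounded. -/
structure IsBoundedInputSystem (f : E n × D → E n) : Prop where
  isBounded_inputs : Bornology.IsBounded D
  exists_norm_zero_le : ∃ C, ∀ d, ‖f (0, d)‖ ≤ C
  locLipState : LocLipState f
  forwardComplete : ForwardComplete f

namespace IsBoundedInputSystem

theorem isInput (H : IsBoundedInputSystem f) (hd : Measurable d) : IsInput d := by
  obtain ⟨M, hM⟩ := H.isBounded_inputs.exists_norm_le
  exact ⟨hd.aemeasurable, fun _ => ⟨M, ae_of_all _ fun t => hM _ (d t).2⟩⟩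

theorem exists_lipschitz (H : IsBoundedInputSystem f) (R : ℝ) :
    ∃ L, 0 < L ∧ ∀ x ∈ closedBall (0 : E n) R, ∀ z ∈ closedBall (0 : E n) R, ∀ d : D,
      ‖f (x, d) - f (z, d)‖ ≤ L * ‖x - z‖ := by
  obtain ⟨L, hL, hlip⟩ :=
    H.locLipState _ (isCompact_closedBall 0 R) D subset_rfl H.isBounded_inputs
  exact ⟨L, hL, fun x hx z hz d => hlip x hx z hz d d.2⟩

theorem exists_bound (H : IsBoundedInputSystem f) (R : ℝ) :
    ∃ B, 0 ≤ B ∧ ∀ z ∈ closedBall (0 : E n) R, ∀ d : D, ‖f (z, d)‖ ≤ B := by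
  obtain ⟨C, hC⟩ := H.exists_norm_zero_le
  obtain ⟨L, hL, hlip⟩ := H.exists_lipschitz R
  refine ⟨max (C + L * R) 0, le_max_right _ _, fun z hz d => le_max_of_le_left ?_⟩
  have hzR : ‖z‖ ≤ R := mem_closedBall_zero_iff.1 hz
  have hdiff := hlip z hz 0 (mem_closedBall_self ((norm_nonneg z).trans hzR)) d
  rw [sub_zero] at hdiff
  calc ‖f (z, d)‖ ≤ ‖f (0, d)‖ + ‖f (z, d) - f (0, d)‖ := norm_le_norm_add_norm_sub' _ _
    _ ≤ C + L * R := add_le_add (hC d) (hdiff.trans (by gcongr))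

theorem isSolution_flow (H : IsBoundedInputSystem f) (hd : Measurable d) (x : E n) :
    IsSolution f d x (fun t => flow f d t x) :=
  Classical.epsilon_spec (p := IsSolution f d x) (H.forwardComplete x d (H.isInput hd))

theorem flow_zero (H : IsBoundedInputSystem f) (hd : Measurable d) (x : E n) :
    flow f d 0 x = x :=
  (H.isSolution_flow hd x).apply_zero

theorem flow_eq_of_eqOn (H : IsBoundedInputSystem f) (hd : Measurable d) {t : ℝ} (ht : 0 ≤ t)
    (hde : EqOn d e (Ico 0 t)) (hx : IsSolution f e x₀ x) : flow f d t x₀ = x t :=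
  (H.isSolution_flow hd x₀).eqOn_of_eqOn_input H.locLipState (H.isInput hd) hx hde
    (right_mem_Icc.2 ht)

theorem flow_add (H : IsBoundedInputSystem f) (hd : Measurable d) {a b : ℝ} (ha : 0 ≤ a)
    (hb : 0 ≤ b) (x : E n) :
    flow f d (a + b) x = flow f (fun t => d (t + a)) b (flow f d a x) := by
  rw [add_comm a b]
  exact (H.flow_eq_of_eqOn (hd.comp (measurable_add_const a)) hb (fun _ _ => rfl)
    ((H.isSolution_flow hd x).shift ha)).symm

theorem flow_concat (H : IsBoundedInputSystem f) (hd : Measurable d) (he : Measurable e)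
    {s t : ℝ} (hs : 0 ≤ s) (ht : 0 ≤ t) (x : E n) :
    flow f (concat d s e) (s + t) x = flow f e t (flow f d s x) := by
  have hde := measurable_concat hd he s
  have hfirst : flow f (concat d s e) s x = flow f d s x :=
    H.flow_eq_of_eqOn hde hs (fun τ hτ => eqOn_concat d s e hτ.2) (H.isSolution_flow hd x)
  rw [H.flow_add hde hs ht, hfirst]
  exact H.flow_eq_of_eqOn (hde.comp (measurable_add_const s)) ht
    (fun τ hτ => concat_add d s e hτ.1) (H.isSolution_flow he _)

theorem exists_short_time (H : IsBoundedInputSystem f) (R : ℝ) :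
    ∃ σ, 0 < σ ∧ ∀ d : ℝ → D, Measurable d → ∀ t ∈ Icc 0 σ,
      MapsTo (flow f d t) (closedBall 0 R) (closedBall 0 (R + 1)) ∧
      ApproximatesLinearOn (flow f d t) (ContinuousLinearMap.id ℝ (E n)) (closedBall 0 R)
        (1 / 2) := by
  obtain ⟨B, hB, hbound⟩ := H.exists_bound (R + 1)
  obtain ⟨L, hL, hlip⟩ := H.exists_lipschitz (R + 1)
  obtain ⟨σ, ⟨hσB, hσL⟩, hσ⟩ : ∃ σ, (B * σ < 1 ∧ L * σ * Real.exp (L * σ) < 1 / 2) ∧ 0 < σ := by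
    have hB0 : Tendsto (fun σ => B * σ) (𝓝 0) (𝓝 0) :=
      (by fun_prop : Continuous fun σ => B * σ).tendsto' _ _ (by simp)
    have hL0 : Tendsto (fun σ => L * σ * Real.exp (L * σ)) (𝓝 0) (𝓝 0) :=
      (by fun_prop : Continuous fun σ => L * σ * Real.exp (L * σ)).tendsto' _ _ (by simp)
    have hsmall := (hB0.eventually_lt_const one_pos).and (hL0.eventually_lt_const one_half_pos)
    exact ((hsmall.filter_mono nhdsWithin_le_nhds).and
      (self_mem_nhdsWithin (a := (0 : ℝ)) (s := Ioi 0))).exists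
  have hstay : ∀ d : ℝ → D, Measurable d → ∀ t ∈ Icc 0 σ,
      MapsTo (flow f d t) (closedBall 0 R) (closedBall 0 (R + 1)) := fun d hd t ht x hx =>
    mem_closedBall_zero_iff.2 ((H.isSolution_flow hd x).norm_lt_of_norm_le hB hbound ht.1
      (add_lt_add_of_le_of_lt (mem_closedBall_zero_iff.1 hx)
        ((mul_le_mul_of_nonneg_left ht.2 hB).trans_lt hσB))).le
  refine ⟨σ, hσ, fun d hd t ht => ⟨hstay d hd t ht, fun x hx y hy => ?_⟩⟩
  have hmem : ∀ τ ∈ Ioc 0 t, τ ∈ Icc 0 σ := fun τ hτ => ⟨hτ.1.le, hτ.2.trans ht.2⟩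
  calc ‖flow f d t x - flow f d t y - (x - y)‖ ≤ L * t * Real.exp (L * t) * ‖x - y‖ :=
        (H.isSolution_flow hd x).norm_sub_sub_le (H.isSolution_flow hd y) hL.le
          (ae_of_all _ fun τ hτ => hlip _ (hstay d hd τ (hmem τ hτ) hx) _
            (hstay d hd τ (hmem τ hτ) hy) _) ht.1
    _ ≤ L * σ * Real.exp (L * σ) * ‖x - y‖ := by gcongr <;> exact ht.2
    _ ≤ (1 / 2 : NNReal) * ‖x - y‖ := by
        push_cast
        gcongr

theorem map_nhds_flow (H : IsBoundedInputSystem f) (hd : Measurable d) {T : ℝ} (hT : 0 ≤ T)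
    (x : E n) : map (flow f d T) (𝓝 x) = 𝓝 (flow f d T x) := by
  obtain ⟨M, hM⟩ := (H.isSolution_flow hd x).exists_norm_le T
  obtain ⟨σ, hσ, hshort⟩ := H.exists_short_time (M + 1)
  suffices key : ∀ N : ℕ, ∀ t ∈ Icc 0 T, t ≤ N * σ →
      map (flow f d t) (𝓝 x) = 𝓝 (flow f d t x) by
    obtain ⟨N, hN⟩ := exists_nat_ge (T / σ)
    exact key N T (right_mem_Icc.2 hT) ((div_le_iff₀ hσ).1 hN)
  intro N
  induction N with
  | zero =>
    intro t ht htN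
    obtain rfl : t = 0 := le_antisymm (by simpa using htN) ht.1
    rw [show flow f d 0 = id from funext (H.flow_zero hd), map_id, id]
  | succ N ih =>
    intro t ht htN
    push_cast at htN
    obtain ⟨a, ha, hat, haσ, haN⟩ : ∃ a, 0 ≤ a ∧ a ≤ t ∧ t - a ≤ σ ∧ a ≤ N * σ :=
      ⟨max (t - σ) 0, le_max_right _ _, max_le (by linarith) ht.1,
        by linarith [le_max_left (t - σ) 0], max_le (by linarith) (by positivity)⟩
    have haT : a ∈ Icc 0 T := ⟨ha, hat.trans ht.2⟩
    have hflow : flow f d t = flow f (fun τ => d (τ + a)) (t - a) ∘ flow f d a := by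
      funext y
      rw [Function.comp, ← H.flow_add hd ha (sub_nonneg.2 hat), add_sub_cancel]
    have hnear := (hshort _ (hd.comp (measurable_add_const a)) _ ⟨sub_nonneg.2 hat, haσ⟩).2
    have hball : closedBall 0 (M + 1) ∈ 𝓝 (flow f d a x) :=
      closedBall_mem_nhds_of_mem (mem_ball_zero_iff.2 ((hM a haT).trans_lt (lt_add_one M)))
    rw [hflow, ← Filter.map_map, ih a haT haN]
    exact map_nhds_eq_of_approximatesLinearOn_id hnear (NNReal.half_lt_self one_ne_zero) hball

theorem image_flow_mem_nhds (H : IsBoundedInputSystem f) (hd : Measurable d) {t : ℝ} (ht : 0 ≤ t)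
    {x : E n} {U : Set (E n)} (hU : U ∈ 𝓝 x) : flow f d t '' U ∈ 𝓝 (flow f d t x) :=
  H.map_nhds_flow hd ht x ▸ image_mem_map hU

end IsBoundedInputSystem

end Flow

section Reachability

variable {n m : ℕ} {D : Set (E m)} {f : E n × D → E n} {A B U : Set (E n)} {x : E n}
  {s t σ T : ℝ} {d e : ℝ → D}

/-- The states reached from `A` at time `t`. Genuinely measurable inputs suffice, since solutions
only depend on the almost everywhere class of the input. -/
def reachAt (f : E n × D → E n) (A : Set (E n)) (t : ℝ) : Set (E n) :=
  {y | ∃ d : ℝ → D, Measurable d ∧ ∃ x ∈ A, flow f d t x = y}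

/-- The states reached from `A` up to time `T`. -/
def reach (f : E n × D → E n) (A : Set (E n)) (T : ℝ) : Set (E n) :=
  ⋃ t ∈ Icc 0 T, reachAt f A t

theorem reachAt_subset_reach (ht : t ∈ Icc 0 T) : reachAt f A t ⊆ reach f A T :=
  subset_biUnion_of_mem (u := reachAt f A) ht

theorem reach_mono (hAB : A ⊆ B) (T : ℝ) : reach f A T ⊆ reach f B T :=
  biUnion_mono subset_rfl fun _ _ _ ⟨d, hd, x, hx, hy⟩ => ⟨d, hd, x, hAB hx, hy⟩

theorem reach_union (A B : Set (E n)) (T : ℝ) :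
    reach f (A ∪ B) T = reach f A T ∪ reach f B T := by
  refine subset_antisymm (iUnion₂_subset fun t ht => ?_)
    (union_subset (reach_mono subset_union_left T) (reach_mono subset_union_right T))
  rintro y ⟨d, hd, x, hx | hx, hy⟩
  · exact Or.inl (reachAt_subset_reach ht ⟨d, hd, x, hx, hy⟩)
  · exact Or.inr (reachAt_subset_reach ht ⟨d, hd, x, hx, hy⟩)

theorem reach_subset_closedBall {R ρ : ℝ} (h : ∀ d : ℝ → D, Measurable d → ∀ t ∈ Icc 0 T,
    MapsTo (flow f d t) (closedBall 0 R) (closedBall 0 ρ)) :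
    reach f (closedBall 0 R) T ⊆ closedBall 0 ρ := by
  refine iUnion₂_subset fun t ht => ?_
  rintro _ ⟨d, hd, x, hx, rfl⟩
  exact h d hd t ht hx

theorem IsBoundedInputSystem.reach_subset (H : IsBoundedInputSystem f) (hσ : 0 ≤ σ) :
    reach f A T ⊆ reach f A σ ∪ reach f (reachAt f A σ) (T - σ) := by
  refine iUnion₂_subset fun t ht => ?_
  rintro _ ⟨d, hd, x, hx, rfl⟩
  rcases le_total t σ with htσ | hσt
  · exact Or.inl (reachAt_subset_reach ⟨ht.1, htσ⟩ ⟨d, hd, x, hx, rfl⟩)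
  · have hflow := H.flow_add hd hσ (sub_nonneg.2 hσt) x
    rw [add_sub_cancel] at hflow
    exact Or.inr (reachAt_subset_reach ⟨sub_nonneg.2 hσt, sub_le_sub_right ht.2 σ⟩
      ⟨_, hd.comp (measurable_add_const σ), _, ⟨d, hd, x, hx, rfl⟩, hflow.symm⟩)

theorem closure_reachAt_closedBall_subset {c : NNReal} {r : ℝ} (hc : c < 1) (hr : 0 < r)
    (hflow : ∀ d : ℝ → D, Measurable d → ApproximatesLinearOn (flow f d t)
      (ContinuousLinearMap.id ℝ (E n)) (closedBall x (2 * r)) c) :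
    closure (reachAt f (closedBall x r) t) ⊆ reachAt f (closedBall x (2 * r)) t := by
  intro p hp
  have hc' : 0 < (1 - c : ℝ) := sub_pos.2 (by exact_mod_cast hc)
  obtain ⟨_, ⟨d, hd, y, hy, rfl⟩, hdist⟩ := mem_closure_iff.1 hp ((1 - c) * r) (mul_pos hc' hr)
  have hball : closedBall y r ⊆ closedBall x (2 * r) :=
    closedBall_subset_closedBall' (by linarith [mem_closedBall.1 hy])
  obtain ⟨z, hz, hzp⟩ := closedBall_subset_image_closedBall (hflow d hd) hr.le hball hdist.le
  exact ⟨d, hd, z, hball hz, hzp⟩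

/-- Solutions starting arbitrarily near `x` get arbitrarily far within time `T`. -/
def EscapesNear (f : E n × D → E n) (x : E n) (T : ℝ) : Prop :=
  ∀ U ∈ 𝓝 x, ¬ Bornology.IsBounded (reach f U T)

theorem exists_escapesNear {K : Set (E n)} (hK : IsCompact K)
    (hunbounded : ¬ Bornology.IsBounded (reach f K T)) : ∃ x ∈ K, EscapesNear f x T := by
  by_contra! hne
  refine hunbounded (hK.induction_on (p := fun A => Bornology.IsBounded (reach f A T)) ?_
    (fun A B hAB hB => hB.subset (reach_mono hAB T))
    (fun A B hA hB => (reach_union A B T).symm ▸ hA.union hB) fun x hx => ?_)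
  · simp [reach, reachAt]
  · obtain ⟨U, hU, hbounded⟩ : ∃ U ∈ 𝓝 x, Bornology.IsBounded (reach f U T) := by
      simpa only [EscapesNear, not_forall, not_not, exists_prop] using hne x hx
    exact ⟨U, mem_nhdsWithin_of_mem_nhds hU, hbounded⟩

theorem IsBoundedInputSystem.exists_mem_closure_escapesNear (H : IsBoundedInputSystem f)
    (hσ : 0 ≤ σ) (hbounded : Bornology.IsBounded (reach f A σ))
    (hunbounded : ¬ Bornology.IsBounded (reach f A T)) :
    ∃ p ∈ closure (reachAt f A σ), EscapesNear f p (T - σ) := by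
  have hreachAt : Bornology.IsBounded (reachAt f A σ) :=
    hbounded.subset (reachAt_subset_reach (right_mem_Icc.2 hσ))
  refine exists_escapesNear hreachAt.isCompact_closure fun hclosure => hunbounded ?_
  exact (hbounded.union (hclosure.subset (reach_mono subset_closure _))).subset (H.reach_subset hσ)

theorem EscapesNear.reach_nonempty (hx : EscapesNear f x T) : (reach f univ T).Nonempty := by
  by_contra! hempty
  exact hx univ univ_mem (hempty ▸ Bornology.isBounded_empty)

theorem EscapesNear.nonneg (hx : EscapesNear f x T) : 0 ≤ T := by
  obtain ⟨y, hy⟩ := hx.reach_nonempty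
  obtain ⟨t, ht, -⟩ := mem_iUnion₂.1 hy
  exact ht.1.trans ht.2

theorem EscapesNear.exists_measurable (hx : EscapesNear f x T) : ∃ d : ℝ → D, Measurable d := by
  obtain ⟨y, hy⟩ := hx.reach_nonempty
  obtain ⟨t, -, d, hd, -⟩ := mem_iUnion₂.1 hy
  exact ⟨d, hd⟩

/-- Following the input `d` from `x` up to time `s` leads to a state near which solutions still
escape before time `T`. -/
structure EscapesAfter (f : E n × D → E n) (T : ℝ) (d : ℝ → D) (s : ℝ) (x : E n) : Prop where
  measurable_input : Measurable d
  time_nonneg : 0 ≤ s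
  escapesNear : EscapesNear f (flow f d s x) (T - s)

theorem EscapesAfter.time_le (hx : EscapesAfter f T d s x) : s ≤ T :=
  sub_nonneg.1 hx.escapesNear.nonneg

namespace IsBoundedInputSystem

theorem escapesAfter_zero (H : IsBoundedInputSystem f) (hd : Measurable d)
    (hx : EscapesNear f x T) : EscapesAfter f T d 0 x :=
  ⟨hd, le_rfl, by rwa [H.flow_zero hd, sub_zero]⟩

theorem escapesAfter_concat (H : IsBoundedInputSystem f) (hd : Measurable d) (hs : 0 ≤ s)
    (he : EscapesAfter f (T - s) e t (flow f d s x)) :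
    EscapesAfter f T (concat d s e) (s + t) x := by
  refine ⟨measurable_concat hd he.measurable_input s, add_nonneg hs he.time_nonneg, ?_⟩
  rw [H.flow_concat hd he.measurable_input hs he.time_nonneg, ← sub_sub]
  exact he.escapesNear

theorem exists_escapesAfter_short_time (H : IsBoundedInputSystem f) (R : ℝ) :
    ∃ σ, 0 < σ ∧ ∀ x T, ‖x‖ ≤ R → EscapesNear f x T → ∀ U ∈ 𝓝 x,
      ∃ y ∈ U, ∃ d, EscapesAfter f T d σ y := by
  obtain ⟨σ, hσ, hshort⟩ := H.exists_short_time (R + 1)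
  refine ⟨σ, hσ, fun x T hx hesc U hU => ?_⟩
  have hR : closedBall 0 (R + 1) ∈ 𝓝 x :=
    closedBall_mem_nhds_of_mem (mem_ball_zero_iff.2 (hx.trans_lt (lt_add_one R)))
  obtain ⟨η, hη, hball⟩ := nhds_basis_closedBall.mem_iff.1 (inter_mem hU hR)
  obtain ⟨r, hr, rfl⟩ : ∃ r, 0 < r ∧ 2 * r = η := ⟨η / 2, half_pos hη, by ring⟩
  have hsmall : closedBall x r ⊆ closedBall 0 (R + 1) :=
    (closedBall_subset_closedBall (by linarith)).trans (hball.trans inter_subset_right)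
  have hbounded : Bornology.IsBounded (reach f (closedBall x r) σ) :=
    isBounded_closedBall.subset ((reach_mono hsmall σ).trans
      (reach_subset_closedBall fun d hd t ht => (hshort d hd t ht).1))
  obtain ⟨p, hp, hpesc⟩ :=
    H.exists_mem_closure_escapesNear hσ.le hbounded (hesc _ (closedBall_mem_nhds x hr))
  have hreach : p ∈ reachAt f (closedBall x (2 * r)) σ :=
    closure_reachAt_closedBall_subset (NNReal.half_lt_self one_ne_zero) hr
      (fun d hd => (hshort d hd σ (right_mem_Icc.2 hσ.le)).2.mono_set
        (hball.trans inter_subset_right)) hp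
  obtain ⟨d, hd, y, hy, rfl⟩ := hreach
  exact ⟨y, (hball hy).1, d, hd, hσ.le, hpesc⟩

theorem exists_escapesAfter_far (H : IsBoundedInputSystem f) (R : ℝ) (hx : EscapesNear f x T)
    (hU : U ∈ 𝓝 x) : ∃ y ∈ U, ∃ d s, EscapesAfter f T d s y ∧ R ≤ ‖flow f d s y‖ := by
  obtain ⟨σ, hσ, hstep⟩ := H.exists_escapesAfter_short_time R
  obtain ⟨N, hN⟩ := exists_nat_gt (T / σ)
  rw [div_lt_iff₀ hσ] at hN
  induction N generalizing x T U with
  | zero => exact absurd hx.nonneg (by simpa using hN)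
  | succ N ih =>
    rcases le_total R ‖x‖ with hfar | hnear
    · obtain ⟨d, hd⟩ := hx.exists_measurable
      exact ⟨x, mem_of_mem_nhds hU, d, 0, H.escapesAfter_zero hd hx, by rwa [H.flow_zero hd]⟩
    obtain ⟨y, hy, d, hyesc⟩ := hstep x T hnear hx (interior U) (interior_mem_nhds.2 hU)
    have himage := H.image_flow_mem_nhds hyesc.measurable_input hσ.le
      (isOpen_interior.mem_nhds hy)
    push_cast at hN
    obtain ⟨_, ⟨z, hz, rfl⟩, e, t, he, hfar⟩ := ih hyesc.escapesNear himage (by linarith)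
    exact ⟨z, interior_subset hz, _, _, H.escapesAfter_concat hyesc.measurable_input hσ.le he,
      by rwa [H.flow_concat hyesc.measurable_input he.measurable_input hσ.le he.time_nonneg]⟩

end IsBoundedInputSystem

/-- A compact set of initial states together with an input on `[0, time)`, after which solutions
still escape before time `T`. Nested stages are what the unbounded solution is built from. -/
structure EscapeStage (f : E n × D → E n) (T : ℝ) where
  states : Set (E n)
  input : ℝ → D
  time : ℝ
  isCompact_states : IsCompact states
  exists_escapesAfter : ∃ x ∈ interior states, EscapesAfter f T input time x

namespace EscapeStage

/-- The stage `q'` continues the stage `q`: it keeps the input of `q` on `[0, q.time)` and shrinks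
the set of initial states. -/
structure Extends (q' q : EscapeStage f T) : Prop where
  states_subset : q'.states ⊆ q.states
  time_le : q.time ≤ q'.time
  eqOn_input : EqOn q'.input q.input (Iio q.time)

theorem Extends.refl (q : EscapeStage f T) : q.Extends q :=
  ⟨subset_rfl, le_rfl, fun _ _ => rfl⟩

theorem Extends.trans {q₁ q₂ q₃ : EscapeStage f T} (h₃ : q₃.Extends q₂) (h₂ : q₂.Extends q₁) :
    q₃.Extends q₁ :=
  ⟨h₃.states_subset.trans h₂.states_subset, h₂.time_le.trans h₃.time_le,
    (h₃.eqOn_input.mono (Iio_subset_Iio h₂.time_le)).trans h₂.eqOn_input⟩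

theorem states_nonempty (q : EscapeStage f T) : q.states.Nonempty :=
  let ⟨x, hx, _⟩ := q.exists_escapesAfter
  ⟨x, interior_subset hx⟩

theorem measurable_input (q : EscapeStage f T) : Measurable q.input :=
  let ⟨_, _, hx⟩ := q.exists_escapesAfter
  hx.measurable_input

theorem time_mem_Icc (q : EscapeStage f T) : q.time ∈ Icc 0 T :=
  let ⟨_, _, hx⟩ := q.exists_escapesAfter
  ⟨hx.time_nonneg, hx.time_le⟩

theorem exists_measurable_eqOn_input {q : ℕ → EscapeStage f T}
    (hq : ∀ i j, i ≤ j → (q j).Extends (q i)) :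
    ∃ d : ℝ → D, Measurable d ∧ ∀ j, EqOn d (q j).input (Iio (q j).time) := by
  refine exists_measurable_piecewise _ (fun _ => measurableSet_Iio) _
    (fun j => (q j).measurable_input) fun i j _ t ht => ?_
  rcases le_total i j with hij | hji
  · exact ((hq i j hij).eqOn_input ht.1).symm
  · exact (hq j i hji).eqOn_input ht.2

end EscapeStage

namespace IsBoundedInputSystem

theorem exists_extends_far (H : IsBoundedInputSystem f) (q : EscapeStage f T) (R : ℝ) :
    ∃ q' : EscapeStage f T, q'.Extends q ∧ ∀ x ∈ q'.states, R < ‖flow f q'.input q'.time x‖ := by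
  obtain ⟨x, hx, hesc⟩ := q.exists_escapesAfter
  have hd := q.measurable_input
  have hs := hesc.time_nonneg
  obtain ⟨_, ⟨y, hy, rfl⟩, e, t, he, hfar⟩ := H.exists_escapesAfter_far (R + 1) hesc.escapesNear
    (H.image_flow_mem_nhds hd hs (isOpen_interior.mem_nhds hx))
  have hyesc := H.escapesAfter_concat hd hs he
  rw [← H.flow_concat hd he.measurable_input hs he.time_nonneg] at hfar
  have hcont : ContinuousAt (flow f (concat q.input q.time e) (q.time + t)) y :=
    (H.map_nhds_flow hyesc.measurable_input hyesc.time_nonneg y).le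
  have hnear : ∀ᶠ z in 𝓝 y, R < ‖flow f (concat q.input q.time e) (q.time + t) z‖ :=
    hcont.norm.eventually_const_lt ((lt_add_one R).trans_le hfar)
  obtain ⟨η, hη, hball⟩ :=
    nhds_basis_closedBall.mem_iff.1 (inter_mem (isOpen_interior.mem_nhds hy) hnear)
  exact ⟨⟨closedBall y η, concat q.input q.time e, q.time + t, isCompact_closedBall _ _,
      y, mem_interior_iff_mem_nhds.2 (closedBall_mem_nhds y hη), hyesc⟩,
    ⟨fun z hz => interior_subset (hball hz).1, le_add_of_nonneg_right he.time_nonneg,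
      eqOn_concat _ _ _⟩,
    fun z hz => (hball hz).2⟩

theorem exists_escapeStage_seq (H : IsBoundedInputSystem f) (hx : EscapesNear f x T) :
    ∃ q : ℕ → EscapeStage f T, (∀ i j, i ≤ j → (q j).Extends (q i)) ∧
      ∀ j : ℕ, ∀ z ∈ (q (j + 1)).states, j < ‖flow f (q (j + 1)).input (q (j + 1)).time z‖ := by
  obtain ⟨d, hd⟩ := hx.exists_measurable
  let q₀ : EscapeStage f T := ⟨closedBall x 1, d, 0, isCompact_closedBall _ _, x,
    mem_interior_iff_mem_nhds.2 (closedBall_mem_nhds x one_pos), H.escapesAfter_zero hd hx⟩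
  choose next hnext hfar using fun (q : EscapeStage f T) (j : ℕ) => H.exists_extends_far q j
  refine ⟨Nat.rec q₀ fun j q => next q j, fun i j hij => ?_, fun j => hfar _ j⟩
  induction j, hij using Nat.le_induction with
  | base => exact EscapeStage.Extends.refl _
  | succ j _ ih => exact (hnext _ j).trans ih

theorem not_escapesNear (H : IsBoundedInputSystem f) (x : E n) (T : ℝ) :
    ¬ EscapesNear f x T := by
  intro hx
  obtain ⟨q, hq, hfar⟩ := H.exists_escapeStage_seq hx
  obtain ⟨z, hz⟩ := IsCompact.nonempty_iInter_of_sequence_nonempty_isCompact_isClosed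
    (fun j => (q j).states) (fun j => (hq j _ j.le_succ).states_subset)
    (fun j => (q j).states_nonempty) (q 0).isCompact_states
    fun j => (q j).isCompact_states.isClosed
  obtain ⟨d, hd, hdq⟩ := EscapeStage.exists_measurable_eqOn_input hq
  obtain ⟨M, hM⟩ := (H.isSolution_flow hd z).exists_norm_le T
  obtain ⟨j, hj⟩ := exists_nat_ge M
  have htime := (q (j + 1)).time_mem_Icc
  have hflow : flow f d (q (j + 1)).time z = flow f (q (j + 1)).input (q (j + 1)).time z :=
    H.flow_eq_of_eqOn hd htime.1 (fun t ht => hdq _ ht.2)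
      (H.isSolution_flow (q (j + 1)).measurable_input z)
  have hlt : j < ‖flow f d (q (j + 1)).time z‖ := hflow ▸ hfar j z (mem_iInter.1 hz (j + 1))
  exact (hlt.trans_le ((hM _ htime).trans hj)).false

theorem isBounded_reach (H : IsBoundedInputSystem f) {K : Set (E n)} (hK : IsCompact K) (T : ℝ) :
    Bornology.IsBounded (reach f K T) := by
  by_contra hunbounded
  obtain ⟨x, -, hx⟩ := exists_escapesNear hK hunbounded
  exact H.not_escapesNear x T hx

theorem mem_reach (H : IsBoundedInputSystem f) (hd : IsInput d) {y : ℝ → E n}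
    (hy : IsSolution f d x y) (hx : x ∈ A) (ht : t ∈ Icc 0 T) : y t ∈ reach f A T :=
  reachAt_subset_reach ht ⟨_, hd.1.measurable_mk, x, hx,
    H.flow_eq_of_eqOn hd.1.measurable_mk ht.1 (fun _ _ => rfl) (hy.congr_input hd.1.ae_eq_mk)⟩

theorem lagrangeOutputStable {k : ℕ} (H : IsBoundedInputSystem f) {h : E n → E k}
    (hh : Continuous h) (hattr : URGOA f h) : LagrangeOutputStable f h := by
  intro δ hδ
  obtain ⟨T, -, hlate⟩ := hattr 1 one_pos δ hδ
  have hreach := H.isBounded_reach (isCompact_closedBall 0 δ) T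
  obtain ⟨C, hC⟩ := hreach.isCompact_closure.exists_bound_of_continuousOn hh.continuousOn
  refine ⟨max C 1, by positivity, fun d hd x₀ hx₀ x hx t ht => ?_⟩
  rcases le_total t T with htT | hTt
  · have hmem := H.mem_reach hd hx (mem_closedBall_zero_iff.2 hx₀) ⟨ht, htT⟩
    exact le_max_of_le_left (hC _ (subset_closure hmem))
  · exact le_max_of_le_right (hlate d hd x₀ hx₀ x hx t hTt)

end IsBoundedInputSystem

end Reachability

end OutputStability

open OutputStability in
theorem theorem1_general {n m k : ℕ} {D : Set (E m)} (hD : D.Nonempty) {f : E n × D → E n}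
    (hf0 : ∀ d, f (0, d) = 0) {h : E n → E k} {V W : E n → ℝ} (hV : C1Nonneg V) (hW : C1Nonneg W)
    {ρ : ℝ → ℝ} (hρ : ContPosDef ρ) (hVdiss : ∀ (x : E n) (d : D), lieDeriv f V x d ≤ -ρ (W x))
    {r : ℝ} (hr : 0 < r) {a : ℝ → ℝ} (ha : ClassK a) (hWh : ∀ x, W x < r → a ‖h x‖ ≤ W x)
    (hWdec : ∀ x, W x < r → ∀ d : D, lieDeriv f W x d ≤ 0)
    (hcond : 0 < liminf (fun s : ℝ => ((ρ s : ℝ) : EReal)) atTop ∨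
      ∃ (ζ : ℝ → ℝ) (Q : E n → ℝ), MonotoneOn ζ (Ici 0) ∧ C1Nonneg Q ∧ (∀ x, W x ≤ ζ (Q x)) ∧
        ∀ (x : E n) (d : D), lieDeriv f Q x d ≤ 0) :
    (URGOA f h ∧ LyapunovOutputStable f h) ∧
    (Bornology.IsBounded D → LocLipState f → ForwardComplete f → Continuous h → URGAOS f h) := by
  have hdecay : DecaysUniformly f V W := by
    rcases hcond with hlim | ⟨ζ, Q, hζ, hQ, hWQ, hQdec⟩
    · exact decaysUniformly_of_liminf_pos hρ hVdiss hlim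
    · exact decaysUniformly_of_le_comp hρ hVdiss hζ hQ hWQ hQdec
  have htrap : TrapsOutput f W h := trapsOutput_of_lieDeriv_nonpos_below hW.1 hr ha hWh hWdec
  have hattr : URGOA f h := urgoa_of_decaysUniformly hV hdecay htrap
  have hW0 : W 0 = 0 := eq_zero_of_lieDeriv_le_neg hD hf0 (hW.2 0) hρ.2.2 hVdiss
  have hlyap : LyapunovOutputStable f h :=
    lyapunovOutputStable_of_trapsOutput hW.1.continuous.continuousAt hW0 htrap
  refine ⟨⟨hattr, hlyap⟩, fun hbounded hlip hfc hh => ⟨?_, hlyap, hattr⟩⟩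
  have H : IsBoundedInputSystem f := ⟨hbounded, ⟨0, fun d => by simp [hf0]⟩, hlip, hfc⟩
  exact H.lagrangeOutputStable hh hattr

theorem theorem1 {n m k : ℕ} (D : Set (OutputStability.E m)) (hD : D.Nonempty)
    (f : OutputStability.E n × D → OutputStability.E n)
    (hf : Continuous f) (hfLip : OutputStability.LocLipState f)
    (hf0 : ∀ d : D, f (0, d) = 0)
    (h : OutputStability.E n → OutputStability.E k) (hh : Continuous h) (hh0 : h 0 = 0)
    (hfc : OutputStability.ForwardComplete f)
    (V W : OutputStability.E n → ℝ)
    (hV : OutputStability.C1Nonneg V) (hW : OutputStability.C1Nonneg W)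
    (ρ : ℝ → ℝ) (hρ : OutputStability.ContPosDef ρ)
    (hVdiss : ∀ (x : OutputStability.E n) (d : D),
      OutputStability.lieDeriv f V x d ≤ -ρ (W x))
    (r : ℝ) (hr : 0 < r) (a : ℝ → ℝ) (ha : OutputStability.ClassK a)
    (hWh : ∀ x : OutputStability.E n, W x < r → a ‖h x‖ ≤ W x)
    (hWdec : ∀ x : OutputStability.E n, W x < r → ∀ d : D,
      OutputStability.lieDeriv f W x d ≤ 0)
    (hcond :
      0 < liminf (fun s : ℝ => ((ρ s : ℝ) : EReal)) atTop ∨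
      ∃ (ζ : ℝ → ℝ) (Q : OutputStability.E n → ℝ),
        OutputStability.ClassKInf ζ ∧ OutputStability.C1Nonneg Q ∧
        (∀ x : OutputStability.E n, W x ≤ ζ (Q x)) ∧
        ∀ (x : OutputStability.E n) (d : D), OutputStability.lieDeriv f Q x d ≤ 0) :
    (OutputStability.URGOA f h ∧ OutputStability.LyapunovOutputStable f h) ∧
    (OutputStability.CompactLipschitz f → OutputStability.URGAOS f h) :=
  (theorem1_general hD hf0 hV hW hρ hVdiss hr ha hWh hWdec
    (hcond.imp_right fun ⟨ζ, Q, hζ, hQ⟩ => ⟨ζ, Q, hζ.1.2.1.monotoneOn, hQ⟩)).imp_right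
    fun hURGAOS hc => hURGAOS hc.1.isBounded hfLip hfc hh
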